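/- Fix an integer $n \ge 2$ and let $K_n$ be the complete graph on the vertex set $\{1,\dots,n\}$ (exactly one edge joins any two distinct vertices), with Laplacian $\Delta = D - A \colon \mathbb Z^n \to \mathbb Z^n$, where $D$ is the diagonal matrix of vertex degrees and $A$ the adjacency matrix. For $\mathbf d \in \mathbb Z^n$ put $\deg(\mathbf d) = d_1 + \cdots + d_n$. Write $\mathbf d \sim \mathbf d'$ if $\mathbf d - \mathbf d' \in \mathrm{Image}(\Delta)$, call $\mathbf d$ effective if all its coordinates are nonnegative, and let $\mathcal N \subset \mathbb Z^n$ be the set of vectors that are not equivalent ($\sim$) to an effective vector. The Baker--Norine rank of $K_n$ is the function $$ r_{\mathrm{BN}} \colon \mathbb Z^n \to \mathbb Z, \qquad r_{\mathrm{BN}}(\mathbf d) = -1 + \min_{\mathbf d' \in \mathcal N} \bigl( |d_1 - d'_1| + \cdots + |d_n - d'_n| \bigr). $$ For $j \in \{1,\dots,n\}$ let $\mathfrak t_j$ be the operator on functions $f \colon \mathbb Z^n \to \mathbb Z$ given by $(\mathfrak t_j f)(\mathbf d) = f(\mathbf d - \mathbf e_j)$, where $\mathbf e_j$ is the $j$-th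 standard basis vector, and let $1$ denote the identity operator. Let $$ \mathcal A = \{0,\dots,n-1\}^{n-2} \times \{0\} \times \mathbb Z \subset \mathbb Z^n, \qquad \mathcal A_{\deg i} = \{ \mathbf a \in \mathcal A : \deg(\mathbf a) = i \} \quad (i \in \mathbb Z), $$ let $\mathcal B = \{0,\dots,n-1\}^{n-2}$, and for $\mathbf b \in \mathcal B$ and $i \in \mathbb Z$ put $$ \langle \mathbf b, i \rangle = (b_1, \dots, b_{n-2}, 0, i - b_1 - \cdots - b_{n-2}) \in \mathbb Z^n. $$ **Theorem.** (1) For every $i \in \mathbb Z$ and every $\mathbf a \in \mathcal A_{\deg i}$, $$ \bigl( (1 - \mathfrak t_n)(1 - \mathfrak t_{n-1}) r_{\mathrm{BN}} \bigr)(\mathbf a) = \begin{cases} 1 & \text{if } a_1 + \cdots + a_{n-2} = i, \\ 0 & \text{otherwise.} \end{cases} $$ (2) For every $\mathbf b \in \mathcal B$ and every $i \in \mathbb Z$, $$ \bigl( (1 - \mathfrak t_n)(1 - \mathfrak t_{n-1}) r_{\mathrm{BN}} \bigr)(\langle \mathbf b, i \rangle) = \begin{cases} 1 & \text{if } b_1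 + \cdots + b_{n-2} = i, \\ 0 & \text{otherwise.} \end{cases} $$ -/

import Mathlib

namespace BakerNorine

/-! ### The Baker-Norine rank of a graph -/

section Rank

variable {V : Type*} [Fintype V]

/-- The degree `d_1 + ⋯ + d_n` of an integer vector. -/
def deg (d : V → ℤ) : ℤ := ∑ v, d v

/-- A vector is effective if all its coordinates are nonnegative. -/
def Effective (d : V → ℤ) : Prop := 0 ≤ d

variable [DecidableEq V]

/-- `d ∼ d'`: the difference lies in the image of the Laplacian `Δ_G : ℤ^V → ℤ^V`. -/
def Equivalent (G : SimpleGraph V) [DecidableRel G.Adj] (d d' : V → ℤ) : Prop :=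
  d - d' ∈ LinearMap.range (Matrix.mulVecLin (G.lapMatrix ℤ))

/-- The set `𝒩` of vectors that are not equivalent to an effective vector. -/
def nonEffective (G : SimpleGraph V) [DecidableRel G.Adj] : Set (V → ℤ) :=
  {d | ¬ ∃ d' : V → ℤ, Effective d' ∧ Equivalent G d d'}

/-- The `L¹` distance between two integer vectors. -/
def l1Dist (d d' : V → ℤ) : ℕ := ∑ v, (d v - d' v).natAbs

/-- `f_G(d)`, the minimum of the `L¹` distances from `d` to the elements of `𝒩`. (As a set of natural
numbers these distances have a least element as soon as `𝒩` is nonempty, which is the case for every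
graph with at least one vertex: vectors of negative degree belong to `𝒩`.) -/
noncomputable def distNonEffective (G : SimpleGraph V) [DecidableRel G.Adj] (d : V → ℤ) : ℕ :=
  sInf (l1Dist d '' nonEffective G)

/-- The Baker-Norine rank `r_BN(d) = f_G(d) - 1`. -/
noncomputable def rank (G : SimpleGraph V) [DecidableRel G.Adj] (d : V → ℤ) : ℤ :=
  (distNonEffective G d : ℤ) - 1

/-- The downward shift operator `𝔱_v` on functions `ℤ^V → ℤ`, `(𝔱_v f)(d) = f(d - e_v)`. -/
def shift (v : V) : Module.End ℤ ((V → ℤ) → ℤ) where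
  toFun f := fun d => f (d - Pi.single v 1)
  map_add' _ _ := rfl
  map_smul' _ _ := rfl

end Rank

/-! ### Coordinates for the complete graph on `n ≥ 2` vertices

The vertices `1, …, n` are the elements `0, …, n - 1` of `Fin n`. -/

/-- The index `j ∈ {1, …, n-2}` viewed in `{1, …, n}`. -/
def initIdx {n : ℕ} (j : Fin (n - 2)) : Fin n := ⟨j, by omega⟩

/-- The index `n - 1` (one-based). -/
def penultIdx {n : ℕ} (hn : 2 ≤ n) : Fin n := ⟨n - 2, by omega⟩

/-- The index `n` (one-based). -/
def lastIdx {n : ℕ} (hn : 2 ≤ n) : Fin n := ⟨n - 1, by omega⟩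

/-- `𝒜(n) = {0,…,n-1}^{n-2} × {0} × ℤ`. -/
def setA {n : ℕ} (hn : 2 ≤ n) : Set (Fin n → ℤ) :=
  {a | (∀ j : Fin (n - 2), 0 ≤ a (initIdx j) ∧ a (initIdx j) ≤ (n : ℤ) - 1) ∧ a (penultIdx hn) = 0}

/-- `𝒜_{deg i}`, the elements of `𝒜` of degree `i`. -/
def setADeg {n : ℕ} (hn : 2 ≤ n) (i : ℤ) : Set (Fin n → ℤ) :=
  {a | a ∈ setA hn ∧ deg a = i}

/-- `ℬ(n) = {0,…,n-1}^{n-2}`. -/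
def setB (n : ℕ) : Set (Fin (n - 2) → ℤ) :=
  {b | ∀ j, 0 ≤ b j ∧ b j ≤ (n : ℤ) - 1}

/-- `⟨b,i⟩ = (b_1, …, b_{n-2}, 0, i - b_1 - ⋯ - b_{n-2})`. -/
def bracket {n : ℕ} (b : Fin (n - 2) → ℤ) (i : ℤ) : Fin n → ℤ := fun k =>
  if h : (k : ℕ) < n - 2 then b ⟨k, h⟩
  else if (k : ℕ) = n - 2 then 0
  else i - ∑ j, b j

end BakerNorine

/-! Let `c` be the total of a firing vector `v`. On `K_n` firing turns `p_k` into `p_k - n v_k + c`,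
so `p ∈ 𝒩` iff `∑ ⌊(p_k + c)/n⌋ < c` for every `c`. This criterion is symmetric in the coordinates
and survives moving multiples of `n` between them.

As `𝒩` is closed downwards, the distance from `d` is the least `∑ max (d_k - p_k) 0` over `p ∈ 𝒩`.
Let `x`, `y` be the last two indices, `y` the free one and `a_x = 0`. Lowering `a_x` drops the
distance by 1 iff some optimal `p` for `a` has `p_x < 0`. Exchanging coordinates of `p` shows that
this happens iff `a_y ≥ 0` (`distNonEffective_eq_add_one`, `distNonEffective_eq_of_neg`).
Differencing this step function in `y` leaves the indicator of `a_y = 0`. -/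

namespace BakerNorine

section CompleteGraph

variable {V : Type*} [Fintype V]

/-- Two functions that agree outside `{i, j}` have sums ordered as their partial sums over
`{i, j}`. -/
theorem sum_le_sum_of_eq_off_pair {g h : V → ℤ} {i j : V} (hij : i ≠ j)
    (heq : ∀ k, k ≠ i → k ≠ j → g k = h k) (hle : g i + g j ≤ h i + h j) :
    ∑ k, g k ≤ ∑ k, h k := by
  have key : ∑ k, (h k - g k) = (h i - g i) + (h j - g j) :=
    Fintype.sum_eq_add i j hij fun k hk => by rw [heq k hk.1 hk.2, sub_self]
  rw [Finset.sum_sub_distrib] at key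
  linarith

/-- The number of firings available to `p + c` in excess of the `c` that are required. -/
def floorExcess (p : V → ℤ) (c : ℤ) : ℤ := ∑ k, (p k + c) / (Fintype.card V : ℤ) - c

theorem floorExcess_mono {p q : V → ℤ} (h : p ≤ q) (c : ℤ) : floorExcess p c ≤ floorExcess q c := by
  refine sub_le_sub_right (Finset.sum_le_sum fun k _ => ?_) c
  have hpos : (0 : ℤ) < Fintype.card V := by exact_mod_cast Fintype.card_pos_iff.mpr ⟨k⟩
  exact Int.ediv_le_ediv hpos (by linarith [h k])

theorem floorExcess_add_card_mul [Nonempty V] (p : V → ℤ) (c t : ℤ) :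
    floorExcess p (c + Fintype.card V * t) = floorExcess p c := by
  have hpos : (0 : ℤ) < Fintype.card V := by exact_mod_cast Fintype.card_pos
  simp only [floorExcess, ← add_assoc, Int.add_mul_ediv_left _ _ hpos.ne', Finset.sum_add_distrib,
    Finset.sum_const, Finset.card_univ, nsmul_eq_mul]
  ring

variable [DecidableEq V]

theorem sum_add_single_one (f : ℤ → ℤ) (p : V → ℤ) (j : V) :
    ∑ k, f ((p + Pi.single j 1 : V → ℤ) k) = ∑ k, f (p k) + (f (p j + 1) - f (p j)) := by
  have key : ∑ k, (f ((p + Pi.single j 1 : V → ℤ) k) - f (p k)) = f (p j + 1) - f (p j) := by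
    rw [Fintype.sum_eq_single j]
    · simp
    · intro k hk
      simp [hk]
  rw [Finset.sum_sub_distrib] at key
  linarith

/-! ### Floor criterion for `𝒩` -/

theorem lapMatrix_top_mulVec (v : V → ℤ) (i : V) :
    ((⊤ : SimpleGraph V).lapMatrix ℤ).mulVec v i = (Fintype.card V : ℤ) * v i - ∑ j, v j := by
  have hpos : 0 < Fintype.card V := Fintype.card_pos_iff.mpr ⟨i⟩
  rw [SimpleGraph.lapMatrix_mulVec_apply]
  have h : (⊤ : SimpleGraph V).neighborFinset i = Finset.univ.erase i := by
    ext k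
    simp [eq_comm]
  rw [h, ← Finset.add_sum_erase Finset.univ v (Finset.mem_univ i),
    SimpleGraph.complete_graph_degree, Nat.cast_sub hpos]
  push_cast
  ring

theorem exists_le_sum_eq [Nonempty V] (w : V → ℤ) (c : ℤ) (hc : c ≤ ∑ k, w k) :
    ∃ v : V → ℤ, v ≤ w ∧ ∑ k, v k = c := by
  obtain ⟨i⟩ := ‹Nonempty V›
  refine ⟨w - Pi.single i (∑ k, w k - c), ?_, ?_⟩
  · rw [sub_le_self_iff, Pi.single_nonneg]
    linarith
  · simp [Finset.sum_sub_distrib]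

theorem mem_nonEffective_top_iff [Nonempty V] (p : V → ℤ) :
    p ∈ nonEffective (⊤ : SimpleGraph V) ↔ ∀ c, floorExcess p c < 0 := by
  have hpos : (0 : ℤ) < Fintype.card V := by exact_mod_cast Fintype.card_pos
  constructor
  · intro hp c
    by_contra! hc
    obtain ⟨v, hv, hsum⟩ := exists_le_sum_eq (fun k => (p k + c) / (Fintype.card V : ℤ)) c
      (sub_nonneg.mp hc)
    refine hp ⟨p - ((⊤ : SimpleGraph V).lapMatrix ℤ).mulVec v, fun k => ?_, v, ?_⟩
    · have h := (Int.le_ediv_iff_mul_le hpos).mp (hv k)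
      simp only [Pi.zero_apply, Pi.sub_apply, lapMatrix_top_mulVec, hsum]
      linarith
    · simp
  · rintro hp ⟨d, hd, v, hv⟩
    refine (hp (∑ k, v k)).not_ge (sub_nonneg.mpr (Finset.sum_le_sum fun k _ => ?_))
    rw [Int.le_ediv_iff_mul_le hpos]
    have h := congrFun hv k
    rw [Matrix.mulVecLin_apply, lapMatrix_top_mulVec, Pi.sub_apply] at h
    have := hd k
    simp only [Pi.zero_apply] at this
    linarith

theorem nonEffective_of_le [Nonempty V] {p q : V → ℤ} (h : p ≤ q)
    (hq : q ∈ nonEffective (⊤ : SimpleGraph V)) : p ∈ nonEffective (⊤ : SimpleGraph V) := by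
  rw [mem_nonEffective_top_iff] at *
  exact fun c => (floorExcess_mono h c).trans_lt (hq c)

theorem exists_mem_nonEffective [Nonempty V] : (nonEffective (⊤ : SimpleGraph V)).Nonempty := by
  have hpos : (0 : ℤ) < Fintype.card V := by exact_mod_cast Fintype.card_pos
  refine ⟨fun _ => -1, (mem_nonEffective_top_iff _).mpr fun c => ?_⟩
  have := Int.mul_ediv_self_le (x := -1 + c) hpos.ne'
  simp only [floorExcess, Finset.sum_const, Finset.card_univ, nsmul_eq_mul]
  linarith

/-- Exchanging two coordinates and moving a multiple of the number of vertices from one to the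
other preserves nonequivalence to effective vectors. -/
theorem exchange_mem_nonEffective [Nonempty V] {p q : V → ℤ} {i j : V} (hij : i ≠ j) (t : ℤ)
    (hp : p ∈ nonEffective (⊤ : SimpleGraph V))
    (hi : q i = p j + Fintype.card V * t) (hj : q j = p i - Fintype.card V * t)
    (heq : ∀ k, k ≠ i → k ≠ j → q k = p k) : q ∈ nonEffective (⊤ : SimpleGraph V) := by
  have hpos : (0 : ℤ) < Fintype.card V := by exact_mod_cast Fintype.card_pos
  rw [mem_nonEffective_top_iff] at *
  intro c
  refine lt_of_le_of_lt (sub_le_sub_right ?_ c) (hp c)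
  refine sum_le_sum_of_eq_off_pair hij (fun k h1 h2 => by rw [heq k h1 h2]) (le_of_eq ?_)
  have e1 : q i + c = (p j + c) + Fintype.card V * t := by rw [hi]; ring
  have e2 : q j + c = (p i + c) + Fintype.card V * (-t) := by rw [hj]; ring
  rw [e1, e2, Int.add_mul_ediv_left _ _ hpos.ne', Int.add_mul_ediv_left _ _ hpos.ne']
  ring

/-! ### Maximal vectors -/

theorem ediv_add_one_eq {m : ℤ} (hm : 0 < m) (x : ℤ) :
    (x + 1) / m = x / m + if m ∣ x + 1 then 1 else 0 := by
  split_ifs with h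
  · obtain ⟨y, hy⟩ := h
    have hx : x = m - 1 + m * (y - 1) := by linear_combination hy
    rw [hy, Int.mul_ediv_cancel_left _ hm.ne', hx, Int.add_mul_ediv_left _ _ hm.ne',
      Int.ediv_eq_zero_of_lt (by linarith) (by linarith)]
    ring
  · have h1 := Int.emod_nonneg x hm.ne'
    have h2 := Int.emod_lt_of_pos x hm
    have h3 := Int.mul_ediv_add_emod x m
    have h4 : x % m + 1 ≠ m := fun h' => h ⟨x / m + 1, by linear_combination h' - h3⟩
    have hx : x + 1 = (x % m + 1) + m * (x / m) := by linear_combination -h3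
    rw [hx, Int.add_mul_ediv_left _ _ hm.ne', Int.ediv_eq_zero_of_lt (by linarith) (by lia)]
    ring

theorem floorExcess_add_single_one [Nonempty V] (p : V → ℤ) (j : V) (c : ℤ) :
    floorExcess (p + Pi.single j 1) c =
      floorExcess p c + if (Fintype.card V : ℤ) ∣ p j + c + 1 then 1 else 0 := by
  have hpos : (0 : ℤ) < Fintype.card V := by exact_mod_cast Fintype.card_pos
  rw [floorExcess, sum_add_single_one (fun z => (z + c) / (Fintype.card V : ℤ)), add_right_comm,
    ediv_add_one_eq hpos, floorExcess]
  ring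

/-- A vector of `𝒩` that leaves `𝒩` whenever a coordinate is raised has excess exactly `-1`. -/
theorem floorExcess_zero_of_maximal [Nonempty V] {p : V → ℤ}
    (hp : p ∈ nonEffective (⊤ : SimpleGraph V))
    (hmax : ∀ j, p + Pi.single j 1 ∉ nonEffective (⊤ : SimpleGraph V)) :
    floorExcess p 0 = -1 := by
  have hpos : (0 : ℤ) < Fintype.card V := by exact_mod_cast Fintype.card_pos
  rw [mem_nonEffective_top_iff] at hp
  -- Raising `p j` changes the excess only at one residue class of `c`, so leaving `𝒩` forces the
  -- value `-1` there.
  have hraise : ∀ j c, (Fintype.card V : ℤ) ∣ p j + c + 1 → floorExcess p c = -1 := by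
    intro j c hc
    have h := hmax j
    rw [mem_nonEffective_top_iff] at h
    push Not at h
    obtain ⟨c', hc'⟩ := h
    rw [floorExcess_add_single_one] at hc'
    have := hp c'
    split_ifs at hc' with hdvd
    · obtain ⟨t, ht⟩ := dvd_sub hc hdvd
      have : c = c' + Fintype.card V * t := by linear_combination ht
      rw [this, floorExcess_add_card_mul]
      linarith
    · linarith
  -- Below `-1` no floor can jump as `c` grows, so the excess only falls; yet within one period it
  -- meets a class where it is `-1`.
  have hstep : ∀ k : ℕ, floorExcess p 0 < -1 → floorExcess p k < -1 := by
    intro k h0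
    induction k with
    | zero => exact_mod_cast h0
    | succ k ih =>
      have hnot : ∀ j, ¬ (Fintype.card V : ℤ) ∣ p j + k + 1 := fun j hj => ih.ne (hraise j k hj)
      have : floorExcess p (k + 1) = floorExcess p k - 1 := by
        simp only [floorExcess, ← add_assoc, ediv_add_one_eq hpos, if_neg (hnot _), add_zero]
        ring
      push_cast
      linarith
  by_contra hne
  have h0 : floorExcess p 0 < -1 := lt_of_le_of_ne (Int.le_sub_one_of_lt (hp 0)) hne
  obtain ⟨j⟩ := ‹Nonempty V›
  have hk : (0 : ℤ) ≤ (-(p j + 1)) % Fintype.card V := Int.emod_nonneg _ hpos.ne'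
  have := hstep ((-(p j + 1)) % Fintype.card V).toNat h0
  rw [Int.toNat_of_nonneg hk] at this
  refine this.ne (hraise j _ ⟨-((-(p j + 1)) / Fintype.card V), ?_⟩)
  linear_combination Int.mul_ediv_add_emod (-(p j + 1)) (Fintype.card V)

/-- Ensures that repeatedly raising coordinates inside `𝒩` terminates. -/
theorem sum_lt_of_mem_nonEffective [Nonempty V] {p : V → ℤ}
    (hp : p ∈ nonEffective (⊤ : SimpleGraph V)) : ∑ k, p k < (Fintype.card V : ℤ) ^ 2 := by
  have hpos : (0 : ℤ) < Fintype.card V := by exact_mod_cast Fintype.card_pos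
  have h := (mem_nonEffective_top_iff p).mp hp 0
  simp only [floorExcess, add_zero, sub_zero] at h
  calc ∑ k, p k ≤ ∑ k, (Fintype.card V * (p k / Fintype.card V) + Fintype.card V) :=
        Finset.sum_le_sum fun k _ => by
          have h2 := Int.emod_lt_of_pos (p k) hpos
          have h3 := Int.mul_ediv_add_emod (p k) (Fintype.card V)
          linarith
    _ = Fintype.card V * ∑ k, p k / (Fintype.card V : ℤ) + (Fintype.card V : ℤ) ^ 2 := by
        rw [Finset.sum_add_distrib, ← Finset.mul_sum]
        simp [pow_two]
    _ < _ := by nlinarith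

theorem exists_ge_floorExcess_zero [Nonempty V] (p : V → ℤ)
    (hp : p ∈ nonEffective (⊤ : SimpleGraph V)) :
    ∃ m ∈ nonEffective (⊤ : SimpleGraph V), p ≤ m ∧ floorExcess m 0 = -1 := by
  induction hN : ((Fintype.card V : ℤ) ^ 2 - ∑ k, p k).toNat using Nat.strong_induction_on
    generalizing p with
  | _ N ih =>
    by_cases hmax : ∀ j, p + Pi.single j 1 ∉ nonEffective (⊤ : SimpleGraph V)
    · exact ⟨p, hp, le_rfl, floorExcess_zero_of_maximal hp hmax⟩
    · push Not at hmax
      obtain ⟨j, hj⟩ := hmax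
      have hsum := sum_add_single_one id p j
      simp only [id] at hsum
      have hlt := sum_lt_of_mem_nonEffective hp
      obtain ⟨m, hm, hle, hm0⟩ := ih _ (by lia) _ hj rfl
      exact ⟨m, hm, (le_add_of_nonneg_right (Pi.single_nonneg.mpr zero_le_one)).trans hle, hm0⟩

/-! ### The distance to `𝒩` -/

/-- Replacing `p` by `d ⊓ p` stays in `𝒩` and removes the cost of coordinates where `p` exceeds `d`.
-/
theorem distNonEffective_le [Nonempty V] (d : V → ℤ) {p : V → ℤ}
    (hp : p ∈ nonEffective (⊤ : SimpleGraph V)) :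
    (distNonEffective (⊤ : SimpleGraph V) d : ℤ) ≤ ∑ k, max (d k - p k) 0 := by
  have h : distNonEffective (⊤ : SimpleGraph V) d ≤ l1Dist d (d ⊓ p) :=
    Nat.sInf_le ⟨_, nonEffective_of_le inf_le_right hp, rfl⟩
  calc (distNonEffective (⊤ : SimpleGraph V) d : ℤ) ≤ (l1Dist d (d ⊓ p) : ℤ) := by exact_mod_cast h
    _ = ∑ k, max (d k - p k) 0 := by
        rw [l1Dist, Nat.cast_sum]
        refine Finset.sum_congr rfl fun k _ => ?_
        rw [Pi.inf_apply]
        lia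

theorem exists_distNonEffective_eq [Nonempty V] (d : V → ℤ) :
    ∃ p ∈ nonEffective (⊤ : SimpleGraph V),
      (distNonEffective (⊤ : SimpleGraph V) d : ℤ) = ∑ k, max (d k - p k) 0 := by
  obtain ⟨p, hp, h⟩ := Nat.sInf_mem ((exists_mem_nonEffective (V := V)).image (l1Dist d))
  refine ⟨p, hp, le_antisymm (distNonEffective_le d hp) ?_⟩
  rw [distNonEffective, ← h, l1Dist, Nat.cast_sum]
  exact Finset.sum_le_sum fun k _ => by lia

/-! ### Effect of lowering one coordinate -/

theorem sum_max_sub_single (a p : V → ℤ) (x : V) :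
    ∑ k, max (a k - p k) 0 =
      ∑ k, max ((a - Pi.single x 1 : V → ℤ) k - p k) 0 + if p x < a x then 1 else 0 := by
  rw [← sub_eq_iff_eq_add', ← Finset.sum_sub_distrib, Fintype.sum_eq_single x]
  · simp only [Pi.sub_apply, Pi.single_eq_same]
    split_ifs <;> lia
  · intro k hk
    simp [hk]

theorem distNonEffective_sub_single_le [Nonempty V] (a : V → ℤ) (x : V) :
    distNonEffective (⊤ : SimpleGraph V) (a - Pi.single x 1) ≤
      distNonEffective (⊤ : SimpleGraph V) a := by
  obtain ⟨p, hp, h⟩ := exists_distNonEffective_eq a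
  have h1 := distNonEffective_le (a - Pi.single x 1) hp
  rw [sum_max_sub_single a p x] at h
  split_ifs at h <;> lia

theorem distNonEffective_le_sub_single_add_one [Nonempty V] (a : V → ℤ) (x : V) :
    distNonEffective (⊤ : SimpleGraph V) a ≤
      distNonEffective (⊤ : SimpleGraph V) (a - Pi.single x 1) + 1 := by
  obtain ⟨p, hp, h⟩ := exists_distNonEffective_eq (a - Pi.single x 1)
  have h1 := distNonEffective_le a hp
  rw [sum_max_sub_single a p x] at h1
  split_ifs at h1 <;> lia

theorem distNonEffective_eq_add_one [Nonempty V] {a : V → ℤ} {x : V} (ha : 0 ≤ a) (hx : a x = 0) :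
    distNonEffective (⊤ : SimpleGraph V) a =
      distNonEffective (⊤ : SimpleGraph V) (a - Pi.single x 1) + 1 := by
  refine le_antisymm (distNonEffective_le_sub_single_add_one a x) ?_
  suffices ∃ q ∈ nonEffective (⊤ : SimpleGraph V), q x < 0 ∧
      ∑ k, max (a k - q k) 0 ≤ distNonEffective (⊤ : SimpleGraph V) a by
    obtain ⟨q, hq, hqx, hle⟩ := this
    have h1 := distNonEffective_le (a - Pi.single x 1) hq
    rw [sum_max_sub_single a q x, if_pos (by lia)] at hle
    lia
  obtain ⟨p, hp, h⟩ := exists_distNonEffective_eq a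
  by_cases hpx : p x < 0
  · exact ⟨p, hp, hpx, h.ge⟩
  -- A vector of `𝒩` is not effective; swapping a negative entry into `x` costs nothing because `a ≥
  -- 0 = a x`.
  obtain ⟨i, hi⟩ : ∃ i, p i < 0 := by
    by_contra! hall
    exact hp ⟨p, hall, 0, by simp⟩
  have hix : i ≠ x := by rintro rfl; exact hpx hi
  refine ⟨p ∘ Equiv.swap i x, exchange_mem_nonEffective hix 0 hp (by simp) (by simp)
    (fun k h1 h2 => by simp [Equiv.swap_apply_of_ne_of_ne h1 h2]), by simpa using hi, ?_⟩
  rw [h]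
  refine sum_le_sum_of_eq_off_pair hix
    (fun k h1 h2 => by simp [Equiv.swap_apply_of_ne_of_ne h1 h2]) ?_
  have hai : 0 ≤ a i := ha i
  simp only [Function.comp_apply, Equiv.swap_apply_left, Equiv.swap_apply_right]
  lia

theorem distNonEffective_eq_of_neg [Nonempty V] {a : V → ℤ} {x y : V} (hxy : y ≠ x)
    (hx : a x = 0) (hy : a y < 0) (ha : ∀ k, k ≠ y → k ≠ x → a k < Fintype.card V) :
    distNonEffective (⊤ : SimpleGraph V) a =
      distNonEffective (⊤ : SimpleGraph V) (a - Pi.single x 1) := by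
  have hpos : (0 : ℤ) < Fintype.card V := by exact_mod_cast Fintype.card_pos
  refine le_antisymm ?_ (distNonEffective_sub_single_le a x)
  set b : V → ℤ := a - Pi.single x 1 with hb
  have hbx : b x = -1 := by simp [hb, hx]
  have hbk : ∀ k, k ≠ x → b k = a k := fun k hk => by simp [hb, hk]
  obtain ⟨p, hp, h⟩ := exists_distNonEffective_eq b
  obtain ⟨m, hm, hpm, hm0⟩ := exists_ge_floorExcess_zero p hp
  have hmb : ∑ k, max (b k - m k) 0 ≤ distNonEffective (⊤ : SimpleGraph V) b :=
    h ▸ Finset.sum_le_sum fun k _ => by have := hpm k; lia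
  suffices ∃ q ∈ nonEffective (⊤ : SimpleGraph V), 0 ≤ q x ∧
      ∑ k, max (b k - q k) 0 ≤ ∑ k, max (b k - m k) 0 by
    obtain ⟨q, hq, hqx, hle⟩ := this
    have h1 := distNonEffective_le a hq
    rw [sum_max_sub_single a q x, if_neg (by lia)] at h1
    lia
  by_cases hmx : 0 ≤ m x
  · exact ⟨m, hm, hmx, le_rfl⟩
  -- Before the exchange `i` costs nothing and `x` costs `-1 - m x`; afterwards `x` costs nothing
  -- and `i` at most `-1 - m x`.
  suffices ∃ i t, i ≠ x ∧ 0 ≤ m i - Fintype.card V * t ∧ b i < m i ∧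
      b i - (m x + Fintype.card V * t) ≤ -1 - m x by
    obtain ⟨i, t, hix, h1, h2, h3⟩ := this
    refine ⟨Function.update (Function.update m i (m x + Fintype.card V * t)) x
      (m i - Fintype.card V * t), exchange_mem_nonEffective hix t hm (by simp [hix]) (by simp)
      (fun k h1 h2 => by simp [h1, h2]), by simpa using h1, ?_⟩
    refine sum_le_sum_of_eq_off_pair hix (fun k h1 h2 => by simp [h1, h2]) ?_
    simp only [Function.update_self, Function.update_of_ne hix, hbx]
    lia
  by_cases hmy : 0 ≤ m y
  · exact ⟨y, 0, hxy, by simpa using hmy, by rw [hbk y hxy]; lia, by rw [hbk y hxy]; lia⟩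
  -- The floors of `m k / n` sum to `-1`, while `x` and `y` together contribute at most `-2`, so
  -- some floor is positive.
  obtain ⟨i, hi⟩ : ∃ i, (Fintype.card V : ℤ) ≤ m i := by
    by_contra! hall
    have hle : ∑ k, m k / (Fintype.card V : ℤ) ≤
        ∑ k, ((if k = y then -1 else 0) + if k = x then (-1 : ℤ) else 0) := by
      refine Finset.sum_le_sum fun k _ => ?_
      by_cases hkneg : m k < 0
      · have := Int.ediv_neg_of_neg_of_pos hkneg hpos
        split_ifs with h1 h2 h2
        · exact absurd (h1.symm.trans h2) hxy
        all_goals lia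
      · rw [if_neg (by rintro rfl; exact hmy (by lia)), if_neg (by rintro rfl; exact hmx (by lia)),
          Int.ediv_eq_zero_of_lt (by lia) (hall k), add_zero]
    rw [Finset.sum_add_distrib] at hle
    simp only [floorExcess, add_zero, sub_zero] at hm0
    simp [hm0] at hle
  have hix : i ≠ x := by rintro rfl; lia
  have hiy : i ≠ y := by rintro rfl; lia
  have := ha i hiy hix
  -- With `t = 1`, `a i < n` bounds the new cost at `i`.
  exact ⟨i, 1, hix, by lia, by rw [hbk i hix]; lia, by rw [hbk i hix]; lia⟩

theorem rank_sub_rank_sub_single [Nonempty V] {a : V → ℤ} {x y : V} (hxy : y ≠ x)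
    (hx : a x = 0) (ha : ∀ k, k ≠ y → k ≠ x → 0 ≤ a k ∧ a k < Fintype.card V) :
    rank (⊤ : SimpleGraph V) a - rank (⊤ : SimpleGraph V) (a - Pi.single x 1) =
      if 0 ≤ a y then 1 else 0 := by
  simp only [rank]
  split_ifs with hy
  · have h0 : 0 ≤ a := fun k => by
      by_cases h1 : k = y
      · exact h1 ▸ hy
      · by_cases h2 : k = x
        · exact h2 ▸ hx.ge
        · exact (ha k h1 h2).1
    rw [distNonEffective_eq_add_one h0 hx]
    push_cast
    ring
  · rw [distNonEffective_eq_of_neg hxy hx (not_le.mp hy) fun k h1 h2 => (ha k h1 h2).2]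
    ring

theorem mixed_difference_rank [Nonempty V] {a : V → ℤ} {x y : V} (hxy : y ≠ x)
    (hx : a x = 0) (ha : ∀ k, k ≠ y → k ≠ x → 0 ≤ a k ∧ a k < Fintype.card V) :
    ((1 - shift y) * (1 - shift x)) (rank (⊤ : SimpleGraph V)) a = if a y = 0 then 1 else 0 := by
  have h1 := rank_sub_rank_sub_single hxy hx ha
  have h2 := rank_sub_rank_sub_single (a := a - Pi.single y 1) hxy (by simp [hx, hxy.symm])
    (fun k hk1 hk2 => by simpa [hk1] using ha k hk1 hk2)
  have h3 : ((1 - shift y) * (1 - shift x)) (rank (⊤ : SimpleGraph V)) a =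
      (rank (⊤ : SimpleGraph V) a - rank (⊤ : SimpleGraph V) (a - Pi.single x 1)) -
      (rank (⊤ : SimpleGraph V) (a - Pi.single y 1) -
        rank (⊤ : SimpleGraph V) (a - Pi.single y 1 - Pi.single x 1)) := rfl
  rw [h3, h1, h2, Pi.sub_apply, Pi.single_eq_same]
  split_ifs <;> lia

end CompleteGraph

/-! ### Specialisation to `𝒜` and `ℬ` -/

section Coordinates

variable {n : ℕ} (hn : 2 ≤ n)

theorem lastIdx_ne_penultIdx : lastIdx hn ≠ penultIdx hn := by
  simp only [lastIdx, penultIdx, ne_eq, Fin.mk.injEq]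
  lia

theorem eq_initIdx_of_ne {k : Fin n} (h1 : k ≠ lastIdx hn) (h2 : k ≠ penultIdx hn) :
    ∃ j : Fin (n - 2), k = initIdx j := by
  simp only [lastIdx, penultIdx, ne_eq, Fin.ext_iff] at h1 h2
  exact ⟨⟨k, by lia⟩, rfl⟩

theorem deg_eq_sum_initIdx (a : Fin n → ℤ) :
    deg a = ∑ j : Fin (n - 2), a (initIdx j) + a (penultIdx hn) + a (lastIdx hn) := by
  obtain ⟨m, rfl⟩ := Nat.exists_eq_add_of_le' hn
  exact (Fin.sum_univ_castSucc a).trans (congrArg (· + _) (Fin.sum_univ_castSucc _))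

theorem mixed_difference_rank_of_mem_setADeg {i : ℤ} {a : Fin n → ℤ} (ha : a ∈ setADeg hn i) :
    ((1 - shift (lastIdx hn)) * (1 - shift (penultIdx hn))) (rank (⊤ : SimpleGraph (Fin n))) a =
      if ∑ j : Fin (n - 2), a (initIdx j) = i then 1 else 0 := by
  obtain ⟨⟨hbox, hx⟩, hdeg⟩ := ha
  have : Nonempty (Fin n) := ⟨lastIdx hn⟩
  rw [mixed_difference_rank (lastIdx_ne_penultIdx hn) hx]
  · rw [deg_eq_sum_initIdx hn, hx] at hdeg
    exact if_congr (by constructor <;> intro <;> linarith) rfl rfl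
  · intro k h1 h2
    obtain ⟨j, rfl⟩ := eq_initIdx_of_ne hn h1 h2
    have := hbox j
    rw [Fintype.card_fin]
    constructor <;> linarith

theorem bracket_initIdx (b : Fin (n - 2) → ℤ) (i : ℤ) (j : Fin (n - 2)) :
    bracket (n := n) b i (initIdx j) = b j := by
  simp [bracket, initIdx]

theorem bracket_mem_setADeg {b : Fin (n - 2) → ℤ} (hb : b ∈ setB n) (i : ℤ) :
    bracket b i ∈ setADeg hn i := by
  have hx : bracket b i (penultIdx hn) = 0 := by simp [bracket, penultIdx]
  have hy : bracket b i (lastIdx hn) = i - ∑ j, b j := by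
    rw [bracket, dif_neg, if_neg] <;> simp only [lastIdx] <;> lia
  refine ⟨⟨fun j => ?_, hx⟩, ?_⟩
  · rw [bracket_initIdx]
    exact hb j
  · rw [deg_eq_sum_initIdx hn, hx, hy]
    simp only [bracket_initIdx]
    ring

end Coordinates

end BakerNorine

theorem mainTheorem4 (n : ℕ) (hn : 2 ≤ n) :
    (∀ (i : ℤ) (a : Fin n → ℤ), a ∈ BakerNorine.setADeg hn i →
      ((1 - BakerNorine.shift (BakerNorine.lastIdx hn)) *
          (1 - BakerNorine.shift (BakerNorine.penultIdx hn)))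
        (BakerNorine.rank (⊤ : SimpleGraph (Fin n))) a =
      if ∑ j : Fin (n - 2), a (BakerNorine.initIdx j) = i then 1 else 0) ∧
    (∀ (b : Fin (n - 2) → ℤ) (i : ℤ), b ∈ BakerNorine.setB n →
      ((1 - BakerNorine.shift (BakerNorine.lastIdx hn)) *
          (1 - BakerNorine.shift (BakerNorine.penultIdx hn)))
        (BakerNorine.rank (⊤ : SimpleGraph (Fin n))) (BakerNorine.bracket b i) =
      if ∑ j : Fin (n - 2), b j = i then 1 else 0) := by
  refine ⟨fun i a ha => BakerNorine.mixed_difference_rank_of_mem_setADeg hn ha, fun b i hb => ?_⟩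
  have h := BakerNorine.mixed_difference_rank_of_mem_setADeg hn
    (BakerNorine.bracket_mem_setADeg hn hb i)
  simpa only [BakerNorine.bracket_initIdx] using h
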